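/- Let $L$ be a distributive lattice with at least two elements, and let $\mathrm{FBL}\langle L\rangle$ be the free Banach lattice generated by $L$: a Banach lattice together with a bounded lattice homomorphism $\delta_L:L\to \mathrm{FBL}\langle L\rangle$ such that for every Banach lattice $X$ and every bounded lattice homomorphism $T:L\to X$ there is a unique Banach lattice homomorphism $\widehat T:\mathrm{FBL}\langle L\rangle\to X$ with $\widehat T\circ\delta_L=T$, and moreover $\|\widehat T\|=\sup_{x\in L}\|Tx\|$. Then the only projection bands of $\mathrm{FBL}\langle L\rangle$ are $\{0\}$ and $\mathrm{FBL}\langle L\rangle$. The same holds for the concrete realization of $\mathrm{FBL}\langle L\rangle$ as a lattice of functions: let $L^*$ be the set of all lattice homomorphisms $x^*:L\to[-1,1]$, and for $f:L^*\to\mathbb R$ put $$\|f\|=\sup\Big\{\sum_{i=1}^m|f(x_i^*)| : m\in\mathbb N,\ x_1^*,\dots,x_m^*\in L^*,\ \sup_{x\in L}\sum_{i=1}^m|x_i^*(x)|\le 1\Big\}.$$ In the space of all positively homogeneous $f:L^*\to\mathbb R$ (that is, $f(\lambda x^*)=\lambda f(x^*)$ whenever $\lambda\ge 0$ and $x^*,\lambda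 x^*\in L^*$) with $\|f\|<\infty$, with the pointwise order, the only projection bands of the norm closure of the vector sublattice generated by the evaluations $x^*\mapsto x^*(x)$, $x\in L$, are $\{0\}$ and the whole closure. (A band of a vector lattice $E$ is an order ideal containing every supremum existing in $E$ of its non-empty subsets; a band $B$ is a projection band if $E=B\oplus B^{d}$, where $B^{d}=\{x\in E: |x|\wedge|b|=0 \text{ for all } b\in B\}$.) -/

import Mathlib

open Set
open scoped ENNReal

universe u v

/-! ### Vector lattices, bands and projection bands -/

section VectorLattice

variable {X : Type v} [AddCommGroup X] [Module ℝ X] [Lattice X]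

/-- An (order) ideal of a vector lattice: a solid linear subspace. -/
def IsOrderIdeal (B : Submodule ℝ X) : Prop :=
  LatticeOrderedAddCommGroup.IsSolid (B : Set X)

/-- A band: an order ideal which contains the supremum, taken in `X`, of each of its nonempty
subsets that has a supremum in `X`. -/
def IsBand (B : Submodule ℝ X) : Prop :=
  IsOrderIdeal B ∧ ∀ (D : Set X) (x : X), D.Nonempty → D ⊆ (B : Set X) → IsLUB D x → x ∈ B

/-- The disjoint complement of a set `A`: all `x` with `|x| ⊓ |a| = 0` for every `a ∈ A`. -/
def disjointCompl (A : Set X) : Set X :=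
  {x | ∀ a ∈ A, |x| ⊓ |a| = 0}

/-- A projection band: a band `B` such that `X` is the sum (automatically direct) of `B` and
its disjoint complement. -/
def IsProjectionBand (B : Submodule ℝ X) : Prop :=
  IsBand B ∧ ∀ x : X, ∃ b ∈ B, ∃ c ∈ disjointCompl (B : Set X), x = b + c

/-- A linear subspace which is closed under the lattice operations. -/
def IsVectorSublattice (S : Submodule ℝ X) : Prop :=
  ∀ ⦃x y : X⦄, x ∈ S → y ∈ S → x ⊔ y ∈ S ∧ x ⊓ y ∈ S

/-- `lat(A)`: the smallest vector sublattice containing `A`. -/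
def latSpan (A : Set X) : Submodule ℝ X :=
  sInf {S : Submodule ℝ X | IsVectorSublattice S ∧ A ⊆ (S : Set X)}

theorem isVectorSublattice_latSpan (A : Set X) : IsVectorSublattice (latSpan A) := by
  intro x y hx hy
  simp only [latSpan, Submodule.mem_sInf, mem_ofPred_eq] at hx hy ⊢
  exact ⟨fun S hS => (hS.1 (hx S hS) (hy S hS)).1, fun S hS => (hS.1 (hx S hS) (hy S hS)).2⟩

end VectorLattice

/-! ### Banach lattices and the free Banach lattice generated by a lattice -/

/-- A (real) Banach lattice: a vector lattice with a complete lattice norm. -/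
class IsBanachLattice (X : Type v) [NormedAddCommGroup X] [NormedSpace ℝ X] [Lattice X] :
    Prop extends IsOrderedAddMonoid X, IsOrderedModule ℝ X, HasSolidNorm X, CompleteSpace X

/-- A bounded linear map that preserves the lattice operations. -/
def IsBanachLatticeHom {X Y : Type*} [NormedAddCommGroup X] [NormedSpace ℝ X] [Lattice X]
    [NormedAddCommGroup Y] [NormedSpace ℝ Y] [Lattice Y] (T : X →L[ℝ] Y) : Prop :=
  ∀ x y : X, T (x ⊔ y) = T x ⊔ T y ∧ T (x ⊓ y) = T x ⊓ T y

/-- The Banach lattice `F`, with the bounded lattice homomorphism `δ : L → F`, is the free Banach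
lattice generated by the lattice `L`: every bounded lattice homomorphism `T` from `L` into a
Banach lattice `X` has a unique extension to a Banach lattice homomorphism `F → X`, and the norm
of the extension is `sup_{x ∈ L} ‖T x‖`.

It is enough to test on `X` in the universe of `L`: the closed vector sublattice generated
by the range of a map on `L` has at most `(|L| + 2^ℵ₀)^ℵ₀` elements. -/
structure IsFreeBanachLattice (L : Type u) [Lattice L] (F : Type u) [NormedAddCommGroup F]
    [NormedSpace ℝ F] [Lattice F] [IsBanachLattice F] (δ : LatticeHom L F) : Prop where
  bounded : BddAbove (range fun x : L => ‖δ x‖)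
  lift : ∀ (X : Type u) [NormedAddCommGroup X] [NormedSpace ℝ X] [Lattice X] [IsBanachLattice X]
    (T : LatticeHom L X), BddAbove (range fun x : L => ‖T x‖) →
    ∃ T' : F →L[ℝ] X, (IsBanachLatticeHom T' ∧ (∀ x : L, T' (δ x) = T x)) ∧
      IsLUB (range fun x : L => ‖T x‖) ‖T'‖ ∧
      ∀ S : F →L[ℝ] X, IsBanachLatticeHom S → (∀ x : L, S (δ x) = T x) → S = T'

/-! ### The realization of the free Banach lattice as a lattice of functions on `L^*` -/

section Concrete

variable (L : Type u) [Lattice L]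

/-- `L^*`: the lattice homomorphisms from `L` to `[-1, 1]`. -/
def LStar : Type u :=
  {φ : LatticeHom L ℝ // ∀ x : L, φ x ∈ Icc (-1 : ℝ) 1}

variable {L}

/-- `f(λ φ) = λ f(φ)` whenever `λ ≥ 0` and `φ` and `λ φ` belong to `L^*`. -/
def IsPosHomogeneous (f : LStar L → ℝ) : Prop :=
  ∀ (c : ℝ) (φ ψ : LStar L), 0 ≤ c → (∀ x : L, ψ.1 x = c * φ.1 x) → f ψ = c * f φ

/-- The norm of the free Banach lattice, with values in `[0, ∞]`: the supremum of
`∑ |f(φ_i)|` over the finite families in `L^*` with `sup_{x ∈ L} ∑ |φ_i(x)| ≤ 1`. -/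
noncomputable def fblNorm (f : LStar L → ℝ) : ℝ≥0∞ :=
  ⨆ (m : ℕ) (φ : Fin m → LStar L) (_ : ∀ x : L, ∑ i, |(φ i).1 x| ≤ 1),
    ENNReal.ofReal (∑ i, |f (φ i)|)

/-- The evaluation `δ_x : L^* → ℝ`. -/
def evalDelta (x : L) : LStar L → ℝ := fun φ => φ.1 x

theorem fblNorm_le_iff {f : LStar L → ℝ} {a : ℝ≥0∞} :
    fblNorm f ≤ a ↔ ∀ (m : ℕ) (φ : Fin m → LStar L), (∀ x : L, ∑ i, |(φ i).1 x| ≤ 1) →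
      ENNReal.ofReal (∑ i, |f (φ i)|) ≤ a := by
  simp only [fblNorm, iSup_le_iff]

theorem le_fblNorm (f : LStar L → ℝ) {m : ℕ} (φ : Fin m → LStar L)
    (h : ∀ x : L, ∑ i, |(φ i).1 x| ≤ 1) :
    ENNReal.ofReal (∑ i, |f (φ i)|) ≤ fblNorm f :=
  fblNorm_le_iff.1 le_rfl m φ h

theorem fblNorm_le_add {f g h : LStar L → ℝ} (H : ∀ φ, |f φ| ≤ |g φ| + |h φ|) :
    fblNorm f ≤ fblNorm g + fblNorm h := by
  refine fblNorm_le_iff.2 fun m φ hφ => ?_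
  calc ENNReal.ofReal (∑ i, |f (φ i)|)
      ≤ ENNReal.ofReal (∑ i, |g (φ i)| + ∑ i, |h (φ i)|) := by
        rw [← Finset.sum_add_distrib]
        exact ENNReal.ofReal_le_ofReal (Finset.sum_le_sum fun i _ => H _)
    _ ≤ ENNReal.ofReal (∑ i, |g (φ i)|) + ENNReal.ofReal (∑ i, |h (φ i)|) :=
        ENNReal.ofReal_add_le
    _ ≤ _ := add_le_add (le_fblNorm g φ hφ) (le_fblNorm h φ hφ)

theorem fblNorm_smul_le (c : ℝ) (f : LStar L → ℝ) :
    fblNorm (c • f) ≤ ENNReal.ofReal |c| * fblNorm f := by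
  refine fblNorm_le_iff.2 fun m φ hφ => ?_
  have : ∑ i, |(c • f) (φ i)| = |c| * ∑ i, |f (φ i)| := by
    simp [Finset.mul_sum, abs_mul]
  rw [this, ENNReal.ofReal_mul (abs_nonneg c)]
  gcongr
  exact le_fblNorm f φ hφ

variable (L)

/-- The Banach lattice generated by the evaluations `δ_x`, `x ∈ L`, inside the space of all
positively homogeneous `f : L^* → ℝ` with `‖f‖ < ∞`: the norm closure, in that space, of the vector
sublattice generated by the evaluations. -/
noncomputable def fblSubmodule : Submodule ℝ (LStar L → ℝ) where
  carrier := {f | IsPosHomogeneous f ∧ fblNorm f < ∞ ∧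
    ∀ ε : ℝ≥0∞, 0 < ε → ∃ g ∈ latSpan (range (evalDelta (L := L))), fblNorm (f - g) < ε}
  zero_mem' := by
    have h0 : fblNorm (0 : LStar L → ℝ) = 0 :=
      le_antisymm (fblNorm_le_iff.2 fun m φ _ => by simp) (zero_le)
    refine ⟨fun c φ ψ _ _ => by simp, by simp [h0], fun ε hε => ⟨0, Submodule.zero_mem _, ?_⟩⟩
    simpa [h0] using hε
  add_mem' := by
    rintro f f' ⟨hf, hn, ha⟩ ⟨hf', hn', ha'⟩
    refine ⟨fun c φ ψ hc h => ?_, ?_, fun ε hε => ?_⟩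
    · simp only [Pi.add_apply, hf c φ ψ hc h, hf' c φ ψ hc h]; ring
    · exact (fblNorm_le_add fun φ => abs_add_le _ _).trans_lt (ENNReal.add_lt_top.2 ⟨hn, hn'⟩)
    · obtain ⟨g, hg, h⟩ := ha (ε / 2) (ENNReal.half_pos hε.ne')
      obtain ⟨g', hg', h'⟩ := ha' (ε / 2) (ENNReal.half_pos hε.ne')
      refine ⟨g + g', Submodule.add_mem _ hg hg', ?_⟩
      refine (fblNorm_le_add (g := f - g) (h := f' - g') fun φ => ?_).trans_lt
        ((ENNReal.add_lt_add h h').trans_le (ENNReal.add_halves ε).le)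
      have : (f + f' - (g + g')) φ = (f - g) φ + (f' - g') φ := by
        simp only [Pi.add_apply, Pi.sub_apply]; ring
      rw [this]
      exact abs_add_le _ _
  smul_mem' := by
    rintro c f ⟨hf, hn, ha⟩
    refine ⟨fun d φ ψ hd h => ?_, ?_, fun ε hε => ?_⟩
    · simp only [Pi.smul_apply, smul_eq_mul, hf d φ ψ hd h]; ring
    · exact (fblNorm_smul_le c f).trans_lt (ENNReal.mul_lt_top ENNReal.ofReal_lt_top hn)
    · have hc : 0 < |c| + 1 := by positivity
      have hc' : ENNReal.ofReal (|c| + 1) ≠ 0 := (ENNReal.ofReal_pos.2 hc).ne'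
      obtain ⟨g, hg, h⟩ := ha (ε / ENNReal.ofReal (|c| + 1))
        (ENNReal.div_pos hε.ne' ENNReal.ofReal_ne_top)
      refine ⟨c • g, Submodule.smul_mem _ c hg, ?_⟩
      rw [← smul_sub]
      refine (fblNorm_smul_le c _).trans_lt ?_
      calc ENNReal.ofReal |c| * fblNorm (f - g)
          ≤ ENNReal.ofReal (|c| + 1) * fblNorm (f - g) := by
            gcongr; linarith
        _ < ENNReal.ofReal (|c| + 1) * (ε / ENNReal.ofReal (|c| + 1)) :=
            (ENNReal.mul_lt_mul_iff_right hc' ENNReal.ofReal_ne_top).2 h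
        _ ≤ ε := ENNReal.mul_div_le

variable {L}

theorem sup_mem_fblSubmodule {f f' : LStar L → ℝ} (h1 : f ∈ fblSubmodule L)
    (h2 : f' ∈ fblSubmodule L) : f ⊔ f' ∈ fblSubmodule L := by
  obtain ⟨hf, hn, ha⟩ := h1
  obtain ⟨hf', hn', ha'⟩ := h2
  refine ⟨fun c φ ψ hc h => ?_, ?_, fun ε hε => ?_⟩
  · simp only [Pi.sup_apply, hf c φ ψ hc h, hf' c φ ψ hc h, mul_max_of_nonneg _ _ hc]
  · refine (fblNorm_le_add (g := f) (h := f') fun φ => ?_).trans_lt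
      (ENNReal.add_lt_top.2 ⟨hn, hn'⟩)
    rcases max_choice (f φ) (f' φ) with h | h <;> simp [h]
  · obtain ⟨g, hg, h⟩ := ha (ε / 2) (ENNReal.half_pos hε.ne')
    obtain ⟨g', hg', h'⟩ := ha' (ε / 2) (ENNReal.half_pos hε.ne')
    refine ⟨g ⊔ g', (isVectorSublattice_latSpan _ hg hg').1, ?_⟩
    refine (fblNorm_le_add (g := f - g) (h := f' - g') fun φ => ?_).trans_lt
      ((ENNReal.add_lt_add h h').trans_le (ENNReal.add_halves ε).le)
    exact (abs_max_sub_max_le_max _ _ _ _).trans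
      (max_le_add_of_nonneg (abs_nonneg _) (abs_nonneg _))

theorem inf_mem_fblSubmodule {f f' : LStar L → ℝ} (h1 : f ∈ fblSubmodule L)
    (h2 : f' ∈ fblSubmodule L) : f ⊓ f' ∈ fblSubmodule L := by
  have : f ⊓ f' = f + f' - f ⊔ f' := by
    ext φ
    have := min_add_max (f φ) (f' φ)
    simp only [Pi.inf_apply, Pi.sub_apply, Pi.add_apply, Pi.sup_apply]
    linarith
  rw [this]
  exact Submodule.sub_mem _ (Submodule.add_mem _ h1 h2) (sup_mem_fblSubmodule h1 h2)

variable (L)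

/-- The free Banach lattice generated by `L`, realized as a lattice of functions on `L^*`. -/
def FBL : Type u := fblSubmodule L

noncomputable instance : AddCommGroup (FBL L) := inferInstanceAs (AddCommGroup (fblSubmodule L))

noncomputable instance : Module ℝ (FBL L) := inferInstanceAs (Module ℝ (fblSubmodule L))

/-- The pointwise lattice operations. -/
noncomputable instance : Lattice (FBL L) :=
  Subtype.lattice (P := fun f : LStar L → ℝ => f ∈ fblSubmodule L)
    (fun _ _ h1 h2 => sup_mem_fblSubmodule h1 h2) (fun _ _ h1 h2 => inf_mem_fblSubmodule h1 h2)

end Concrete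

/-!
A projection band `B` splits each generator `δ x` into disjoint parts `b x + c x`. If the ambient
vector lattice is realized by continuous functions on a connected space on which the generators have
no common zero, then the sets where some `b x`, respectively some `c x`, does not vanish are open,
disjoint, and cover the space. So one of them is empty, which leaves only `B = ⊥` and `B = ⊤`
(`isProjectionBand_iff_of_connected`).

The space is `L^* \ {0}` with pointwise convergence. It is connected: `φ` is joined to the constant
`1` by `φ ⊔ t` if it takes a positive value, and to `-1` by `φ ⊓ t` if it takes a negative value; and
by the prime ideal theorem some homomorphism takes the values `-1` and `1`. Distributivity and the
presence of two elements are needed here.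

For the concrete lattice `FBL L` the realization is restriction to `L^* \ {0}`; it is injective
by positive homogeneity, and its values are continuous as uniform limits. For an abstract free Banach
lattice `F` it is the extension `F → C_b(L^* \ {0})` of the evaluations, and the point is that it is
injective. Uniqueness of extensions shows that the vector sublattice generated by `L` is dense in `F`
(`IsFreeBanachLattice.mem_closure_latSpan`), and on that sublattice the norm is dominated by
a multiple of the supremum norm (`norm_le_of_forall_abs_le`). For the latter, if `g` is generated by elements of
`[m, M]` and its image is bounded by `ε`, then `|g| ≤ ε (|δ m| + |δ M|)` in `F`. Otherwise a real
lattice homomorphism on the ideal generated by `|δ m| + |δ M|` violates the inequality, and its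
composition with the retraction `x ↦ m ⊔ x ⊓ M` of `L` onto `[m, M]` is, up to a factor, a
homomorphism in `L^*` at which the image of `g` exceeds `ε`. Such real homomorphisms are
minimal elements among the monotone sublinear functionals that preserve suprema
(`IsSupSublinear.exists_latticeHom_le`).
-/

/-! ### Real-valued lattice homomorphisms on vector lattices -/

section SublinearFunctionals

variable {E : Type v} [AddCommGroup E] [Module ℝ E] [Lattice E]

/-- A monotone sublinear functional on a vector lattice that preserves binary suprema. Positive
homogeneity is stated as an inequality; the reverse inequality follows on rescaling by `c⁻¹`. -/
structure IsSupSublinear (p : E → ℝ) : Prop where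
  smul_le : ∀ c : ℝ, 0 < c → ∀ x, p (c • x) ≤ c * p x
  add_le : ∀ x y, p (x + y) ≤ p x + p y
  mono : Monotone p
  sup_le : ∀ x y, p (x ⊔ y) ≤ max (p x) (p y)

namespace IsSupSublinear

variable {p : E → ℝ}

theorem map_smul (hp : IsSupSublinear p) {c : ℝ} (hc : 0 < c) (x : E) : p (c • x) = c * p x := by
  refine le_antisymm (hp.smul_le c hc x) ?_
  have h := hp.smul_le c⁻¹ (inv_pos.2 hc) (c • x)
  rw [inv_smul_smul₀ hc.ne'] at h
  calc c * p x ≤ c * (c⁻¹ * p (c • x)) := by gcongr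
    _ = p (c • x) := by field_simp

theorem map_zero (hp : IsSupSublinear p) : p 0 = 0 := by
  have := hp.map_smul (c := 2) two_pos 0
  rw [smul_zero] at this
  linarith

theorem neg_map_neg_le (hp : IsSupSublinear p) (x : E) : -p (-x) ≤ p x := by
  have := hp.add_le x (-x)
  rw [add_neg_cancel, hp.map_zero] at this
  linarith

/-- The pointwise infimum of a family of functionals is sup-preserving and sublinear as soon as the
family is directed downwards and is sublinear jointly; the members themselves need not be
sublinear. Directedness is what makes the infimum commute with binary suprema. -/
theorem iInf {ι : Type*} [Nonempty ι] {q : ι → E → ℝ} (hb : ∀ x, BddBelow (range fun i => q i x))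
    (hsmul : ∀ c : ℝ, 0 < c → ∀ i, ∃ j, ∀ x, q j (c • x) ≤ c * q i x)
    (hadd : ∀ i j, ∃ k, ∀ x y, q k (x + y) ≤ q i x + q j y)
    (hdir : ∀ i j, ∃ k, q k ≤ q i ∧ q k ≤ q j)
    (hmono : ∀ i, Monotone (q i)) (hsup : ∀ i x y, q i (x ⊔ y) ≤ max (q i x) (q i y)) :
    IsSupSublinear fun x => ⨅ i, q i x where
  smul_le c hc x := by
    rw [Real.mul_iInf_of_nonneg hc.le]
    refine le_ciInf fun i => ?_
    obtain ⟨j, hj⟩ := hsmul c hc i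
    exact (ciInf_le (hb _) j).trans (hj x)
  add_le x y := by
    refine le_ciInf_add_ciInf fun i j => ?_
    obtain ⟨k, hk⟩ := hadd i j
    exact (ciInf_le (hb _) k).trans (hk x y)
  mono x y hxy := ciInf_mono (hb x) fun i => hmono i hxy
  sup_le x y := by
    by_contra! h
    obtain ⟨h1, h2⟩ := max_lt_iff.1 h
    obtain ⟨i, hi⟩ := exists_lt_of_ciInf_lt h1
    obtain ⟨j, hj⟩ := exists_lt_of_ciInf_lt h2
    obtain ⟨k, hki, hkj⟩ := hdir i j
    exact absurd ((ciInf_le (hb _) k).trans (hsup k x y))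
      (not_le.2 (max_lt ((hki x).trans_lt hi) ((hkj y).trans_lt hj)))

/-- The largest sublinear functional below `p` that is linear along `y`, as in the proof of the
Hahn–Banach theorem, is still sup-preserving. -/
theorem exists_le_map_neg_le (hp : IsSupSublinear p) (y : E) [IsOrderedAddMonoid E] :
    ∃ q : E → ℝ, IsSupSublinear q ∧ q ≤ p ∧ q (-y) ≤ -p y := by
  have hty : ∀ t : {t : ℝ // 0 ≤ t}, p (t.1 • y) = t.1 * p y := by
    rintro ⟨t, ht⟩
    rcases ht.eq_or_lt with rfl | ht
    · simp [hp.map_zero]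
    · exact hp.map_smul ht y
  have hanti : ∀ (s t : {t : ℝ // 0 ≤ t}) x,
      p (x + (s + t).1 • y) - (s + t).1 * p y ≤ p (x + s.1 • y) - s.1 * p y := by
    intro s t x
    have h := hp.add_le (x + s.1 • y) (t.1 • y)
    rw [hty t, add_assoc, ← add_smul] at h
    change p (x + (s.1 + t.1) • y) - (s.1 + t.1) * p y ≤ _
    linarith
  have hb : ∀ x, BddBelow (range fun t : {t : ℝ // 0 ≤ t} => p (x + t.1 • y) - t.1 * p y) := by
    intro x
    refine ⟨-p (-x), ?_⟩
    rintro _ ⟨t, rfl⟩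
    have h := hp.add_le (x + t.1 • y) (-x)
    rw [add_neg_cancel_comm, hty t] at h
    change _ ≤ p (x + t.1 • y) - t.1 * p y
    linarith
  refine ⟨fun x => ⨅ t : {t : ℝ // 0 ≤ t}, (p (x + t.1 • y) - t.1 * p y),
    iInf (q := fun (t : {t : ℝ // 0 ≤ t}) x => p (x + t.1 • y) - t.1 * p y) hb ?_ ?_ ?_ ?_ ?_,
    fun x => ?_, ?_⟩
  · intro c hc t
    refine ⟨⟨c * t.1, mul_nonneg hc.le t.2⟩, fun x => ?_⟩
    have h := hp.smul_le c hc (x + t.1 • y)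
    rw [smul_add, smul_smul] at h
    change p (c • x + (c * t.1) • y) - c * t.1 * p y ≤ c * (p (x + t.1 • y) - t.1 * p y)
    linarith
  · intro s t
    refine ⟨s + t, fun x x' => ?_⟩
    have h := hp.add_le (x + s.1 • y) (x' + t.1 • y)
    rw [add_add_add_comm, ← add_smul] at h
    change p (x + x' + (s.1 + t.1) • y) - (s.1 + t.1) * p y ≤ _
    linarith
  · intro s t
    exact ⟨s + t, fun x => hanti s t x, fun x => by rw [add_comm s t]; exact hanti t s x⟩
  · intro t x x' h
    exact sub_le_sub_right (hp.mono (add_le_add_left h _)) _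
  · intro t x x'
    rw [sup_add, max_sub_sub_right]
    exact sub_le_sub_right (hp.sup_le _ _) _
  · simpa using ciInf_le (hb x) ⟨0, le_rfl⟩
  · simpa [hp.map_zero] using ciInf_le (hb (-y)) ⟨1, zero_le_one⟩

/-- By Zorn's lemma there is a minimal sup-preserving sublinear functional below `p`. -/
theorem exists_minimal_le (hp : IsSupSublinear p) :
    ∃ m ≤ p, Minimal (fun q : E → ℝ => IsSupSublinear q) m := by
  obtain ⟨m, hm, hmax⟩ := zorn_le_nonempty₀ (α := (E → ℝ)ᵒᵈ)
    {q | IsSupSublinear (E := E) (OrderDual.ofDual q) ∧ OrderDual.ofDual q ≤ p}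
    (fun c hc hchain q₀ hq₀ => by
      let q : c → E → ℝ := fun i => OrderDual.ofDual i.1
      have hq : ∀ i, IsSupSublinear (q i) := fun i => (hc i.2).1
      have hqp : ∀ i, q i ≤ p := fun i => (hc i.2).2
      have : Nonempty c := ⟨⟨q₀, hq₀⟩⟩
      have hb : ∀ x, BddBelow (range fun i => q i x) := by
        refine fun x => ⟨-p (-x), ?_⟩
        rintro _ ⟨i, rfl⟩
        exact (neg_le_neg (hqp i _)).trans ((hq i).neg_map_neg_le x)
      have hdir : ∀ i j, ∃ k, q k ≤ q i ∧ q k ≤ q j := by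
        intro i j
        rcases hchain.total i.2 j.2 with h | h
        · exact ⟨j, h, le_rfl⟩
        · exact ⟨i, le_rfl, h⟩
      refine ⟨OrderDual.toDual fun x => ⨅ i, q i x, ⟨?_, ?_⟩, ?_⟩
      · refine iInf hb (fun c hc i => ⟨i, (hq i).smul_le c hc⟩) (fun i j => ?_) hdir
          (fun i => (hq i).mono) fun i => (hq i).sup_le
        obtain ⟨k, hki, hkj⟩ := hdir i j
        exact ⟨k, fun x y => ((hq k).add_le x y).trans (add_le_add (hki x) (hkj y))⟩
      · exact fun x => (ciInf_le (hb x) ⟨q₀, hq₀⟩).trans (hqp _ x)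
      · exact fun z hz x => ciInf_le (hb x) ⟨z, hz⟩)
    (OrderDual.toDual p) ⟨hp, le_rfl⟩
  refine ⟨OrderDual.ofDual m, hm, hmax.1.1, fun q hq hqm => ?_⟩
  exact hmax.2 (y := OrderDual.toDual q) ⟨hq, hqm.trans hmax.1.2⟩ hqm

/-- A version of the Hahn–Banach theorem for lattice homomorphisms: below a sup-preserving
sublinear functional that is positive at `a` there is a real-valued lattice homomorphism that is
positive at `a`. -/
theorem exists_latticeHom_le [IsOrderedAddMonoid E] (hp : IsSupSublinear p) {a : E}
    (ha : 0 < p a) :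
    ∃ h : E →ₗ[ℝ] ℝ, (∀ x, h x ≤ p x) ∧ 0 < h a ∧ (∀ x y, h (x ⊔ y) = max (h x) (h y)) ∧
      ∀ x y, h (x ⊓ y) = min (h x) (h y) := by
  obtain ⟨q, hq, hqp, hqa⟩ := hp.exists_le_map_neg_le a
  obtain ⟨m, hmq, hm, hmin⟩ := hq.exists_minimal_le
  have hneg : ∀ x, m (-x) = -m x := by
    intro x
    obtain ⟨r, hr, hrm, hrx⟩ := hm.exists_le_map_neg_le x
    have h1 := hm.neg_map_neg_le x
    have h2 := hmin hr hrm (-x)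
    linarith
  have hadd : ∀ x y, m (x + y) = m x + m y := by
    intro x y
    have h1 := hm.add_le x y
    have h2 := hm.add_le (x + y) (-y)
    rw [add_neg_cancel_right, hneg] at h2
    linarith
  have hsup : ∀ x y, m (x ⊔ y) = max (m x) (m y) := fun x y =>
    le_antisymm (hm.sup_le x y) (max_le (hm.mono le_sup_left) (hm.mono le_sup_right))
  refine ⟨{ toFun := m, map_add' := hadd, map_smul' := fun c x => ?_ }, fun x =>
    (hmq x).trans (hqp x), ?_, hsup, fun x y => ?_⟩
  · rcases lt_trichotomy c 0 with hc | rfl | hc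
    · have h := hm.map_smul (neg_pos.2 hc) x
      rw [neg_smul, hneg] at h
      simp only [RingHom.id_apply, smul_eq_mul]
      linarith
    · simp [hm.map_zero]
    · exact hm.map_smul hc x
  · have h1 := hneg a
    have h2 := hmq (-a)
    change 0 < m a
    linarith
  · change m (x ⊓ y) = min (m x) (m y)
    rw [← neg_neg (x ⊓ y), neg_inf, hneg, hsup, hneg, hneg, max_neg_neg, neg_neg]

end IsSupSublinear

end SublinearFunctionals

/-! ### Vector sublattices as vector lattices -/

section Sublattice

variable {X : Type v} [AddCommGroup X] [Module ℝ X] [Lattice X]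

theorem subset_latSpan (A : Set X) : A ⊆ (latSpan A : Set X) := by
  intro x hx
  simp only [latSpan, SetLike.mem_coe, Submodule.mem_sInf, mem_ofPred_eq]
  exact fun S hS => hS.2 hx

theorem latSpan_le {A : Set X} {S : Submodule ℝ X} (hS : IsVectorSublattice S)
    (h : A ⊆ (S : Set X)) : latSpan A ≤ S :=
  sInf_le ⟨hS, h⟩

/-- The lattice structure induced on a vector sublattice. -/
abbrev IsVectorSublattice.lattice {S : Submodule ℝ X} (hS : IsVectorSublattice S) : Lattice S :=
  Subtype.lattice (P := fun x => x ∈ S) (fun _ _ hx hy => (hS hx hy).1)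
    fun _ _ hx hy => (hS hx hy).2

theorem IsVectorSublattice.isOrderedAddMonoid [IsOrderedAddMonoid X] {S : Submodule ℝ X}
    (hS : IsVectorSublattice S) :
    letI := hS.lattice
    IsOrderedAddMonoid S :=
  letI := hS.lattice
  { add_le_add_left := fun _ _ h c => add_le_add_left (α := X) h c }

/-- The ideal generated by `u ≥ 0` in a vector lattice. The bound `|x| ≤ c u` is split into
`x ≤ c u` and `-x ≤ c u`. -/
def principalIdeal [IsOrderedAddMonoid X] [IsOrderedModule ℝ X] (u : X) : Submodule ℝ X where
  carrier := {x | ∃ c : ℝ, 0 ≤ c ∧ x ≤ c • u ∧ -x ≤ c • u}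
  zero_mem' := ⟨0, le_rfl, by simp, by simp⟩
  add_mem' := by
    rintro x y ⟨c, hc, h1, h2⟩ ⟨d, hd, h3, h4⟩
    refine ⟨c + d, add_nonneg hc hd, ?_, ?_⟩
    · rw [add_smul]; exact add_le_add h1 h3
    · rw [add_smul, neg_add]; exact add_le_add h2 h4
  smul_mem' := by
    rintro a x ⟨c, hc, h1, h2⟩
    rcases le_total 0 a with ha | ha
    · refine ⟨a * c, mul_nonneg ha hc, ?_, ?_⟩
      · rw [mul_smul]; exact smul_le_smul_of_nonneg_left h1 ha
      · rw [mul_smul, ← smul_neg]; exact smul_le_smul_of_nonneg_left h2 ha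
    · have ha' : 0 ≤ -a := neg_nonneg.2 ha
      refine ⟨-a * c, mul_nonneg ha' hc, ?_, ?_⟩
      · rw [mul_smul, ← neg_smul_neg]; exact smul_le_smul_of_nonneg_left h2 ha'
      · rw [mul_smul, ← neg_smul]; exact smul_le_smul_of_nonneg_left h1 ha'

theorem isVectorSublattice_principalIdeal [IsOrderedAddMonoid X] [IsOrderedModule ℝ X] {u : X}
    (hu : 0 ≤ u) : IsVectorSublattice (principalIdeal u) := by
  rintro x y ⟨c, hc, h1, h2⟩ ⟨d, hd, h3, h4⟩
  have hcu : c • u ≤ (c + d) • u := smul_le_smul_of_nonneg_right (by linarith) hu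
  have hdu : d • u ≤ (c + d) • u := smul_le_smul_of_nonneg_right (by linarith) hu
  refine ⟨⟨c + d, add_nonneg hc hd, sup_le (h1.trans hcu) (h3.trans hdu), ?_⟩,
    ⟨c + d, add_nonneg hc hd, inf_le_left.trans (h1.trans hcu), ?_⟩⟩
  · exact (neg_le_neg le_sup_left).trans (h2.trans hcu)
  · rw [neg_inf]; exact sup_le (h2.trans hcu) (h4.trans hdu)

/-- The functional `x ↦ inf {c ≥ 0 : x ≤ c u}` on the ideal generated by `u`. -/
theorem isSupSublinear_gauge [IsOrderedAddMonoid X] [IsOrderedModule ℝ X] {u : X} (hu : 0 ≤ u) :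
    letI := (isVectorSublattice_principalIdeal hu).lattice
    IsSupSublinear fun x : principalIdeal u => sInf {c : ℝ | 0 ≤ c ∧ (x : X) ≤ c • u} := by
  let := (isVectorSublattice_principalIdeal hu).lattice
  have hb : ∀ x : X, BddBelow {c : ℝ | 0 ≤ c ∧ x ≤ c • u} := fun x => ⟨0, fun c hc => hc.1⟩
  have hn : ∀ x : principalIdeal u, {c : ℝ | 0 ≤ c ∧ (x : X) ≤ c • u}.Nonempty := by
    rintro ⟨x, c, hc, h, -⟩
    exact ⟨c, hc, h⟩
  have hlt : ∀ (x : principalIdeal u) (b : ℝ), sInf {c : ℝ | 0 ≤ c ∧ (x : X) ≤ c • u} < b →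
      ∃ c : ℝ, 0 ≤ c ∧ (x : X) ≤ c • u ∧ c < b := fun x b h => by
    obtain ⟨c, hc, hcb⟩ := exists_lt_of_csInf_lt (hn x) h
    exact ⟨c, hc.1, hc.2, hcb⟩
  refine ⟨fun a ha x => ?_, fun x y => ?_, fun x y hxy => ?_, fun x y => ?_⟩
  · refine le_of_forall_gt fun b hb' => ?_
    obtain ⟨c, hc, hx, hcb⟩ := hlt x (b / a) (by rwa [lt_div_iff₀' ha])
    refine (csInf_le (hb _) ⟨mul_nonneg ha.le hc, ?_⟩).trans_lt ((lt_div_iff₀' ha).1 hcb)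
    rw [mul_smul]
    exact smul_le_smul_of_nonneg_left hx ha.le
  · refine le_of_forall_pos_le_add fun ε hε => ?_
    obtain ⟨c, hc, hx, hcb⟩ := hlt x _ (lt_add_of_pos_right _ (half_pos hε))
    obtain ⟨d, hd, hy, hdb⟩ := hlt y _ (lt_add_of_pos_right _ (half_pos hε))
    have : sInf {c : ℝ | 0 ≤ c ∧ ((x + y : principalIdeal u) : X) ≤ c • u} ≤ c + d :=
      csInf_le (hb _) ⟨add_nonneg hc hd, by rw [add_smul]; exact add_le_add hx hy⟩
    linarith
  · exact csInf_le_csInf (hb _) (hn y) fun c hc => ⟨hc.1, le_trans (α := X) hxy hc.2⟩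
  · refine le_of_forall_gt fun b hb' => ?_
    obtain ⟨h1, h2⟩ := max_lt_iff.1 hb'
    obtain ⟨c, hc, hx, hcb⟩ := hlt x b h1
    obtain ⟨d, hd, hy, hdb⟩ := hlt y b h2
    refine (csInf_le (hb _) ⟨hc.trans (le_max_left c d), ?_⟩).trans_lt (max_lt hcb hdb)
    exact sup_le (α := X) (hx.trans (smul_le_smul_of_nonneg_right (le_max_left _ _) hu))
      (hy.trans (smul_le_smul_of_nonneg_right (le_max_right _ _) hu))

end Sublattice

/-! ### Projection bands in lattices of continuous functions on a connected space -/

section Functions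

variable {X : Type v} [AddCommGroup X] [Module ℝ X] [Lattice X]

/-- Suppose a vector lattice embeds into the continuous functions on a connected space `K`, and
contains elements `e i` without a common zero. If `X = B ⊕ Bᵈ` and `e i = b i + c i` accordingly,
then the open sets `⋃ {b i ≠ 0}` and `⋃ {c i ≠ 0}` partition `K`, so one of them is empty. -/
theorem isProjectionBand_iff_of_connected {K : Type*} [TopologicalSpace K] [PreconnectedSpace K]
    (R : X →ₗ[ℝ] K → ℝ) (hinj : Function.Injective R) (hcont : ∀ x, Continuous (R x))
    (hsup : ∀ x y, R (x ⊔ y) = R x ⊔ R y) (hinf : ∀ x y, R (x ⊓ y) = R x ⊓ R y)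
    {ι : Type*} (e : ι → X) (he : ∀ k, ∃ i, R (e i) k ≠ 0) (B : Submodule ℝ X) :
    IsProjectionBand B ↔ B = ⊥ ∨ B = ⊤ := by
  have habs : ∀ x k, R |x| k = |R x k| := fun x k => by
    rw [abs, hsup, map_neg]; rfl
  have hmono : ∀ x y, x ≤ y → ∀ k, R x k ≤ R y k := fun x y h k => by
    have := congrFun (hsup x y) k
    rw [sup_eq_right.2 h] at this
    rw [this]
    exact le_sup_left (a := R x k)
  have hdisj : ∀ x y k, |x| ⊓ |y| = 0 → R x k = 0 ∨ R y k = 0 := fun x y k h => by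
    have := congrFun (hinf |x| |y|) k
    rw [h, map_zero, Pi.inf_apply, habs, habs, Pi.zero_apply] at this
    rcases min_choice |R x k| |R y k| with h' | h'
    · exact .inl (abs_eq_zero.1 (h'.symm.trans this.symm))
    · exact .inr (abs_eq_zero.1 (h'.symm.trans this.symm))
  have hzero : ∀ x, (∀ k, R x k = 0) → x = 0 := fun x h =>
    hinj ((funext h).trans (map_zero R).symm)
  constructor
  · rintro ⟨-, hB⟩
    choose b hb c hc hbc using fun i => hB (e i)
    let U : Set K := {k | ∃ i, R (b i) k ≠ 0}
    let V : Set K := {k | ∃ i, R (c i) k ≠ 0}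
    have hU : IsOpen U := by
      simp only [U, ofPred_exists]
      exact isOpen_iUnion fun i => isOpen_ne_fun (hcont _) continuous_const
    have hV : IsOpen V := by
      simp only [V, ofPred_exists]
      exact isOpen_iUnion fun i => isOpen_ne_fun (hcont _) continuous_const
    have hUV : Uᶜ = V := by
      ext k
      constructor
      · intro hk
        obtain ⟨i, hi⟩ := he k
        refine ⟨i, fun h => hi ?_⟩
        have h' : R (b i) k = 0 := by_contra fun h' => hk ⟨i, h'⟩
        rw [hbc i, map_add, Pi.add_apply, h, h', add_zero]
      · rintro ⟨j, hj⟩ ⟨i, hi⟩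
        exact (hdisj _ _ k (hc j _ (hb i))).elim hj hi
    rcases isClopen_iff.1 (⟨isOpen_compl_iff.1 (hUV ▸ hV), hU⟩ : IsClopen U) with h | h
    · left
      refine (Submodule.eq_bot_iff _).2 fun x hx => hzero x fun k => ?_
      have hk : k ∈ V := by rw [← hUV, h]; simp
      obtain ⟨i, hi⟩ := hk
      exact (hdisj _ _ k (hc i x hx)).resolve_left hi
    · right
      refine (Submodule.eq_top_iff'.2 fun x => ?_)
      obtain ⟨y, hy, z, hz, rfl⟩ := hB x
      have : z = 0 := hzero z fun k => by
        obtain ⟨i, hi⟩ : k ∈ U := h ▸ mem_univ k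
        exact (hdisj _ _ k (hz _ (hb i))).resolve_right hi
      rwa [this, add_zero]
  · rintro (rfl | rfl)
    · refine ⟨⟨fun x hx y hxy => ?_, fun D x hD hDB hx => ?_⟩, fun x => ⟨0, rfl, x, ?_, by simp⟩⟩
      · rw [SetLike.mem_coe, Submodule.mem_bot] at hx ⊢
        refine hzero y fun k => ?_
        have := hmono _ _ hxy k
        rw [habs, habs, hx, map_zero, Pi.zero_apply, abs_zero] at this
        exact abs_nonpos_iff.1 this
      · have : D = {0} := hD.subset_singleton_iff.1 hDB
        rw [this] at hx
        exact hx.unique isLUB_singleton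
      · rintro a ha
        rw [SetLike.mem_coe, Submodule.mem_bot] at ha
        refine hzero _ fun k => ?_
        rw [hinf, Pi.inf_apply, habs, habs, ha, map_zero, Pi.zero_apply, abs_zero]
        exact min_eq_right (abs_nonneg _)
    · refine ⟨⟨fun x _ y _ => trivial, fun D x _ _ _ => trivial⟩, fun x =>
        ⟨x, trivial, 0, fun a _ => hzero _ fun k => ?_, by simp⟩⟩
      rw [hinf, Pi.inf_apply, habs, habs, map_zero, Pi.zero_apply, abs_zero]
      exact min_eq_left (abs_nonneg _)

end Functions

/-! ### Connectedness of the space of nonzero homomorphisms -/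

section Connected

variable {L : Type u} [Lattice L]

/-- The topology of pointwise convergence on `L^*`. -/
instance : TopologicalSpace (LStar L) :=
  TopologicalSpace.induced (fun φ x => φ.1 x) Pi.topologicalSpace

theorem continuous_evalDelta (x : L) : Continuous (evalDelta x) :=
  (continuous_apply x).comp continuous_induced_dom

variable (L) in
/-- The space `L^* \ {0}` with the topology of pointwise convergence. -/
abbrev NonzeroLStar : Type u := {φ : LStar L // ∃ x, φ.1 x ≠ 0}

/-- The composition of a homomorphism in `L^*` with a monotone map of `[-1, 1]` into itself. -/
def LStar.comp (φ : LStar L) (g : ℝ → ℝ) (hg : Monotone g)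
    (hg1 : MapsTo g (Icc (-1) 1) (Icc (-1) 1)) : LStar L :=
  ⟨{ toFun := fun x => g (φ.1 x)
     map_sup' := fun x y => by rw [map_sup, hg.map_sup]
     map_inf' := fun x y => by rw [map_inf, hg.map_inf] }, fun x => hg1 (φ.2 x)⟩

/-- The constant homomorphism `c`. -/
def LStar.const (c : Icc (-1 : ℝ) 1) : LStar L :=
  ⟨{ toFun := fun _ => c, map_sup' := fun _ _ => (sup_idem _).symm,
     map_inf' := fun _ _ => (inf_idem _).symm }, fun _ => c.2⟩

variable [Nonempty L]

variable (L) in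
/-- The constant homomorphism `1`, as a nonzero homomorphism. -/
def NonzeroLStar.one : NonzeroLStar L :=
  ⟨LStar.const ⟨1, by norm_num⟩, Classical.arbitrary L, one_ne_zero⟩

variable (L) in
/-- The constant homomorphism `-1`, as a nonzero homomorphism. -/
def NonzeroLStar.negOne : NonzeroLStar L :=
  ⟨LStar.const ⟨-1, by norm_num⟩, Classical.arbitrary L, by
    change (-1 : ℝ) ≠ 0
    norm_num⟩

/-- If `φ` takes a positive value, then so does `φ ⊔ t` for all `t ∈ [-1, 1]`: this path joins `φ`
to `1` without meeting `0`. -/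
theorem NonzeroLStar.one_mem_connectedComponent (φ : NonzeroLStar L) {x : L} (hx : 0 < φ.1.1 x) :
    one L ∈ connectedComponent φ := by
  let γ : Icc (-1 : ℝ) 1 → NonzeroLStar L := fun t =>
    ⟨φ.1.comp (fun s => max s t) (fun _ _ h => max_le_max_right _ h)
      fun s hs => ⟨hs.1.trans (le_max_left _ _), max_le hs.2 t.2.2⟩, x,
      (hx.trans_le (le_max_left (φ.1.1 x) t)).ne'⟩
  have hγ : Continuous γ := by
    refine Continuous.subtype_mk (continuous_induced_rng.2 (continuous_pi fun y => ?_)) _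
    exact (continuous_const (y := φ.1.1 y)).max continuous_subtype_val
  have h1 : γ ⟨-1, by norm_num⟩ = φ :=
    Subtype.ext (Subtype.ext (LatticeHom.ext fun y => max_eq_left (φ.1.2 y).1))
  have h2 : γ ⟨1, by norm_num⟩ = one L :=
    Subtype.ext (Subtype.ext (LatticeHom.ext fun y => max_eq_right (φ.1.2 y).2))
  have := Subtype.preconnectedSpace (isPreconnected_Icc (a := (-1 : ℝ)) (b := 1))
  have := (isPreconnected_range hγ).subset_connectedComponent (mem_range_self ⟨-1, by norm_num⟩)
  rw [h1] at this
  exact this ⟨_, h2⟩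

/-- If `φ` takes a negative value, then `φ ⊓ t`, `t ∈ [-1, 1]`, joins `φ` to `-1`. -/
theorem NonzeroLStar.negOne_mem_connectedComponent (φ : NonzeroLStar L) {x : L}
    (hx : φ.1.1 x < 0) : negOne L ∈ connectedComponent φ := by
  let γ : Icc (-1 : ℝ) 1 → NonzeroLStar L := fun t =>
    ⟨φ.1.comp (fun s => min s t) (fun _ _ h => min_le_min_right _ h)
      fun s hs => ⟨le_min hs.1 t.2.1, (min_le_left _ _).trans hs.2⟩, x,
      ((min_le_left (φ.1.1 x) t).trans_lt hx).ne⟩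
  have hγ : Continuous γ := by
    refine Continuous.subtype_mk (continuous_induced_rng.2 (continuous_pi fun y => ?_)) _
    exact (continuous_const (y := φ.1.1 y)).min continuous_subtype_val
  have h1 : γ ⟨1, by norm_num⟩ = φ :=
    Subtype.ext (Subtype.ext (LatticeHom.ext fun y => min_eq_left (φ.1.2 y).2))
  have h2 : γ ⟨-1, by norm_num⟩ = negOne L :=
    Subtype.ext (Subtype.ext (LatticeHom.ext fun y => min_eq_right (φ.1.2 y).1))
  have := Subtype.preconnectedSpace (isPreconnected_Icc (a := (-1 : ℝ)) (b := 1))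
  have := (isPreconnected_range hγ).subset_connectedComponent (mem_range_self ⟨1, by norm_num⟩)
  rw [h1] at this
  exact this ⟨_, h2⟩

end Connected

/-- A distributive lattice with two elements has a homomorphism into `{-1, 1}` that takes both
values. -/
theorem exists_lStar_eq_neg_one_eq_one (L : Type u) [DistribLattice L] [Nontrivial L] :
    ∃ (φ : LStar L) (a b : L), φ.1 a = -1 ∧ φ.1 b = 1 := by
  classical
  obtain ⟨x, y, hxy⟩ := exists_pair_ne L
  have hlt : x ⊓ y < x ⊔ y := inf_lt_sup.2 hxy
  obtain ⟨J, hJ, hI, hF⟩ := DistribLattice.prime_ideal_of_disjoint_filter_ideal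
    (F := Order.PFilter.principal (x ⊔ y)) (I := Order.Ideal.principal (x ⊓ y))
    (disjoint_left.2 fun z hz hz' => hlt.not_ge (le_trans (Order.PFilter.mem_principal.1 hz)
      (Order.Ideal.mem_principal.1 hz')))
  have ha : x ⊓ y ∈ J := hI (Order.Ideal.mem_principal.2 le_rfl)
  have hb : x ⊔ y ∉ J := disjoint_left.1 hF (Order.PFilter.mem_principal.2 le_rfl)
  refine ⟨⟨{ toFun := fun z => if z ∈ J then -1 else 1, map_sup' := fun z w => ?_,
             map_inf' := fun z w => ?_ }, fun z => ?_⟩, x ⊓ y, x ⊔ y, if_pos ha, if_neg hb⟩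
  · have : z ⊔ w ∈ J ↔ z ∈ J ∧ w ∈ J := Order.Ideal.sup_mem_iff
    by_cases hz : z ∈ J <;> by_cases hw : w ∈ J <;> simp [this, hz, hw]
  · have : z ⊓ w ∈ J ↔ z ∈ J ∨ w ∈ J :=
      ⟨hJ.mem_or_mem, fun h => h.elim (J.lower inf_le_left) (J.lower inf_le_right)⟩
    by_cases hz : z ∈ J <;> by_cases hw : w ∈ J <;> simp [this, hz, hw]
  · change (if z ∈ J then (-1 : ℝ) else 1) ∈ Icc (-1 : ℝ) 1
    split_ifs <;> norm_num

instance (L : Type u) [DistribLattice L] [Nontrivial L] : PreconnectedSpace (NonzeroLStar L) := by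
  obtain ⟨χ, a, b, ha, hb⟩ := exists_lStar_eq_neg_one_eq_one L
  -- `χ` takes values of both signs, which puts `1` and `-1` into the same component.
  let χ' : NonzeroLStar L := ⟨χ, b, by rw [hb]; exact one_ne_zero⟩
  have h1 := connectedComponent_eq
    (NonzeroLStar.one_mem_connectedComponent χ' (x := b) (by change 0 < χ.1 b; rw [hb]; norm_num))
  have h2 := connectedComponent_eq
    (NonzeroLStar.negOne_mem_connectedComponent χ' (x := a) (by change χ.1 a < 0; rw [ha]; norm_num))
  have h : ∀ φ : NonzeroLStar L, connectedComponent φ = connectedComponent χ' := by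
    intro φ
    obtain ⟨x, hx⟩ := φ.2
    rcases hx.lt_or_gt with hx | hx
    · rw [connectedComponent_eq (φ.negOne_mem_connectedComponent hx), h2]
    · rw [connectedComponent_eq (φ.one_mem_connectedComponent hx), h1]
  exact preconnectedSpace_iff_connectedComponent.2 fun φ => eq_univ_of_forall fun ψ =>
    (h φ).trans (h ψ).symm ▸ mem_connectedComponent

/-! ### The lattice of functions on `L^*` -/

section Concrete

variable {L : Type u} [Lattice L]

theorem ofReal_abs_apply_le_fblNorm (f : LStar L → ℝ) (φ : LStar L) :
    ENNReal.ofReal |f φ| ≤ fblNorm f := by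
  have := le_fblNorm f (fun _ : Fin 1 => φ) fun x => by
    simpa using abs_le.2 (φ.2 x)
  simpa using this

/-- The norm of `FBL L` dominates the supremum norm, so its elements are uniform limits of
continuous functions. -/
theorem continuous_of_mem_fblSubmodule {f : LStar L → ℝ} (hf : f ∈ fblSubmodule L) :
    Continuous f := by
  let S : Submodule ℝ (LStar L → ℝ) :=
    { carrier := {g | Continuous g}
      zero_mem' := continuous_const
      add_mem' := fun h h' => Continuous.add h h'
      smul_mem' := fun c _ h => Continuous.const_smul h c }
  have hS : latSpan (range (evalDelta (L := L))) ≤ S := latSpan_le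
    (fun g g' h h' => ⟨Continuous.sup h h', Continuous.inf h h'⟩)
    (range_subset_iff.2 continuous_evalDelta)
  refine continuous_of_uniform_approx_of_continuous fun u hu => ?_
  obtain ⟨ε, hε, hεu⟩ := Metric.mem_uniformity_dist.1 hu
  obtain ⟨g, hg, hfg⟩ := hf.2.2 (ENNReal.ofReal ε) (ENNReal.ofReal_pos.2 hε)
  refine ⟨g, hS hg, fun φ => hεu ?_⟩
  exact (ENNReal.ofReal_lt_ofReal_iff hε).1 ((ofReal_abs_apply_le_fblNorm (f - g) φ).trans_lt hfg)

theorem evalDelta_mem_fblSubmodule (x : L) : evalDelta x ∈ fblSubmodule L := by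
  refine ⟨fun c φ ψ _ h => h x, lt_of_le_of_lt (b := 1) ?_ ENNReal.one_lt_top, fun ε hε =>
    ⟨evalDelta x, subset_latSpan _ (mem_range_self x), ?_⟩⟩
  · exact fblNorm_le_iff.2 fun m φ hφ => ENNReal.ofReal_le_one.2 (hφ x)
  · rw [sub_self]
    exact (fblNorm_le_iff.2 fun m φ _ => by simp).trans_lt hε

variable (L) in
/-- The restriction of the functions in `FBL L` to `L^* \ {0}`. -/
noncomputable def restrictNonzero : FBL L →ₗ[ℝ] NonzeroLStar L → ℝ where
  toFun f φ := f.1 φ.1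
  map_add' _ _ := rfl
  map_smul' _ _ := rfl

theorem restrictNonzero_injective : Function.Injective (restrictNonzero L) := by
  refine (injective_iff_map_eq_zero _).2 fun f hf => Subtype.ext (funext fun φ => ?_)
  by_cases h : ∃ x, φ.1 x ≠ 0
  · exact congrFun hf ⟨φ, h⟩
  · -- Positive homogeneity with factor `0` forces functions in `FBL L` to vanish at `0`.
    push Not at h
    have := f.2.1 0 φ φ le_rfl fun x => by rw [h x, zero_mul]
    rwa [zero_mul] at this

end Concrete

theorem FBL.isProjectionBand_iff (L : Type u) [DistribLattice L] [Nontrivial L]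
    (B : Submodule ℝ (FBL L)) : IsProjectionBand B ↔ B = ⊥ ∨ B = ⊤ :=
  isProjectionBand_iff_of_connected (restrictNonzero L) restrictNonzero_injective
    (fun f => (continuous_of_mem_fblSubmodule f.2).comp continuous_subtype_val)
    (fun _ _ => rfl) (fun _ _ => rfl)
    (fun x : L => (⟨evalDelta x, evalDelta_mem_fblSubmodule x⟩ : FBL L))
    (fun φ => φ.2) B

/-! ### Lattice homomorphisms and the norm on the sublattice generated by `L` -/

section Archimedean

variable {X : Type v} [NormedAddCommGroup X] [NormedSpace ℝ X] [Lattice X] [IsBanachLattice X]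

theorem self_mem_principalIdeal {u : X} (hu : 0 ≤ u) : u ∈ principalIdeal u :=
  ⟨1, zero_le_one, by rw [one_smul], by rw [one_smul]; exact (neg_nonpos.2 hu).trans hu⟩

/-- The lattice homomorphisms from the ideal generated by `u` to `ℝ` determine the order. The order
being closed makes the gauge of `u` positive at `x` unless `x ≤ 0`. -/
theorem exists_latticeHom_pos {u : X} (hu : 0 ≤ u) (x : principalIdeal u) (hx : ¬ (x : X) ≤ 0) :
    letI := (isVectorSublattice_principalIdeal hu).lattice
    ∃ h : principalIdeal u →ₗ[ℝ] ℝ, 0 < h x ∧ (∀ y z, h (y ⊔ z) = max (h y) (h z)) ∧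
      ∀ y z, h (y ⊓ z) = min (h y) (h z) := by
  let := (isVectorSublattice_principalIdeal hu).lattice
  have := (isVectorSublattice_principalIdeal hu).isOrderedAddMonoid
  obtain ⟨h, -, hpos, hsup, hinf⟩ := (isSupSublinear_gauge hu).exists_latticeHom_le (a := x) <| by
    by_contra! hle
    have hbd : ∀ ε : ℝ, 0 < ε → (x : X) ≤ ε • u := fun ε hε => by
      have hne : {c : ℝ | 0 ≤ c ∧ (x : X) ≤ c • u}.Nonempty := by
        obtain ⟨c, hc, h, -⟩ := x.2
        exact ⟨c, hc, h⟩
      obtain ⟨c, hc, hcε⟩ := exists_lt_of_csInf_lt hne (hle.trans_lt hε)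
      exact hc.2.trans (smul_le_smul_of_nonneg_right hcε.le hu)
    have hlim : Filter.Tendsto (fun ε : ℝ => ε • u) (nhdsWithin 0 (Ioi 0)) (nhds 0) := by
      have : Continuous fun ε : ℝ => ε • u := by fun_prop
      simpa using (this.tendsto 0).mono_left nhdsWithin_le_nhds
    exact hx (ge_of_tendsto hlim (eventually_mem_nhdsWithin.mono hbd))
  exact ⟨h, hpos, hsup, hinf⟩

end Archimedean

section Estimate

/-- The retraction of a distributive lattice onto the interval `[m, M]`. -/
def intervalRetraction {L : Type u} [DistribLattice L] (m M : L) : LatticeHom L L where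
  toFun x := m ⊔ x ⊓ M
  map_sup' x y := by rw [inf_sup_right, sup_sup_distrib_left]
  map_inf' x y := by rw [inf_inf_distrib_right, sup_inf_left]

theorem intervalRetraction_mem {L : Type u} [DistribLattice L] {m M : L} (h : m ≤ M) (x : L) :
    intervalRetraction m M x ∈ Icc m M :=
  ⟨le_sup_left, sup_le h inf_le_right⟩

theorem intervalRetraction_eq {L : Type u} [DistribLattice L] {m M x : L} (hx : x ∈ Icc m M) :
    intervalRetraction m M x = x := by
  change m ⊔ x ⊓ M = x
  rw [inf_eq_left.2 hx.2, sup_eq_right.2 hx.1]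

theorem latSpan_mono {X : Type v} [AddCommGroup X] [Module ℝ X] [Lattice X] {A B : Set X}
    (h : A ⊆ B) : latSpan A ≤ latSpan B :=
  latSpan_le (isVectorSublattice_latSpan B) (h.trans (subset_latSpan B))

/-- An element of the vector sublattice generated by a lattice only involves the elements of some
interval. -/
theorem exists_mem_latSpan_image_Icc {L : Type u} [Lattice L] [Nonempty L] {X : Type v}
    [AddCommGroup X] [Module ℝ X] [Lattice X] (δ : L → X) {g : X} (hg : g ∈ latSpan (range δ)) :
    ∃ m M : L, m ≤ M ∧ g ∈ latSpan (δ '' Icc m M) := by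
  have key : ∀ {x y : X}, (∃ m M : L, m ≤ M ∧ x ∈ latSpan (δ '' Icc m M)) →
      (∃ m M : L, m ≤ M ∧ y ∈ latSpan (δ '' Icc m M)) →
      ∃ m M : L, m ≤ M ∧ x ∈ latSpan (δ '' Icc m M) ∧ y ∈ latSpan (δ '' Icc m M) := by
    rintro x y ⟨m, M, h, hx⟩ ⟨m', M', -, hy⟩
    exact ⟨m ⊓ m', M ⊔ M', inf_le_left.trans (h.trans le_sup_left),
      latSpan_mono (image_mono (Icc_subset_Icc inf_le_left le_sup_left)) hx,
      latSpan_mono (image_mono (Icc_subset_Icc inf_le_right le_sup_right)) hy⟩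
  let S : Submodule ℝ X :=
    { carrier := {x | ∃ m M : L, m ≤ M ∧ x ∈ latSpan (δ '' Icc m M)}
      zero_mem' := ⟨Classical.arbitrary L, _, le_rfl, Submodule.zero_mem _⟩
      add_mem' := fun hx hy => by
        obtain ⟨m, M, h, hx, hy⟩ := key hx hy
        exact ⟨m, M, h, Submodule.add_mem _ hx hy⟩
      smul_mem' := fun c _ ⟨m, M, h, hx⟩ => ⟨m, M, h, Submodule.smul_mem _ c hx⟩ }
  refine latSpan_le (S := S) (fun x y hx hy => ?_) ?_ hg
  · obtain ⟨m, M, h, hx, hy⟩ := key hx hy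
    obtain ⟨h1, h2⟩ := isVectorSublattice_latSpan _ hx hy
    exact ⟨⟨m, M, h, h1⟩, ⟨m, M, h, h2⟩⟩
  · rintro _ ⟨x, rfl⟩
    exact ⟨x, x, le_rfl, subset_latSpan _ ⟨x, ⟨le_rfl, le_rfl⟩, rfl⟩⟩

variable {L : Type u} [DistribLattice L] {F : Type v} [NormedAddCommGroup F] [NormedSpace ℝ F]
  [Lattice F] [IsBanachLattice F]

/-- Let `R` be a lattice homomorphism on `F` extending the evaluations. On the part of `F`
generated by `[m, M]`, the absolute value of `g` is dominated by the supremum norm of `R g` times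
`|δ m| + |δ M|`.

If this failed, some real-valued lattice homomorphism `h` on the ideal generated by
`|δ m| + |δ M|` would detect it. Composed with the retraction of `L` onto `[m, M]` and normalized,
`h` becomes a nonzero element of `L^*` at which `R g` is too large. -/
theorem abs_le_smul_of_forall_abs_le (δ : LatticeHom L F) (R : F →ₗ[ℝ] NonzeroLStar L → ℝ)
    (hsup : ∀ x y, R (x ⊔ y) = R x ⊔ R y) (hinf : ∀ x y, R (x ⊓ y) = R x ⊓ R y)
    (hδ : ∀ x φ, R (δ x) φ = φ.1.1 x) {m M : L} (hmM : m ≤ M) {g : F}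
    (hg : g ∈ latSpan (δ '' Icc m M)) {ε : ℝ} (hε : ∀ φ, |R g φ| ≤ ε) :
    |g| ≤ ε • (|δ m| + |δ M|) := by
  set u := |δ m| + |δ M|
  have hu : 0 ≤ u := add_nonneg (abs_nonneg _) (abs_nonneg _)
  have hI := isVectorSublattice_principalIdeal hu
  let := hI.lattice
  have huI := self_mem_principalIdeal hu
  have hδI : ∀ x ∈ Icc m M, δ x ∈ principalIdeal u := by
    refine fun x hx => ⟨1, zero_le_one, ?_, ?_⟩ <;> rw [one_smul]
    · exact (OrderHomClass.mono δ hx.2).trans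
        ((le_abs_self _).trans (le_add_of_nonneg_left (abs_nonneg _)))
    · exact (neg_le_neg (OrderHomClass.mono δ hx.1)).trans
        ((neg_le_abs _).trans (le_add_of_nonneg_right (abs_nonneg _)))
  have hgI : g ∈ principalIdeal u := latSpan_le hI (image_subset_iff.2 hδI) hg
  have habsI : ∀ {x : F}, x ∈ principalIdeal u → |x| ∈ principalIdeal u := fun hx =>
    (hI hx (Submodule.neg_mem _ hx)).1
  by_contra hcon
  obtain ⟨h, hpos, hhsup, hhinf⟩ := exists_latticeHom_pos hu
    (⟨|g|, habsI hgI⟩ - ε • ⟨u, huI⟩) (by simpa [sub_nonpos] using hcon)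
  rw [map_sub, map_smul, smul_eq_mul, sub_pos] at hpos
  have habs : ∀ {x : F} (hx : x ∈ principalIdeal u), h ⟨|x|, habsI hx⟩ = |h ⟨x, hx⟩| := by
    intro x hx
    have := hhsup ⟨x, hx⟩ (-⟨x, hx⟩)
    rw [map_neg] at this
    exact this
  have hmono : ∀ {x y : principalIdeal u}, (x : F) ≤ y → h x ≤ h y := fun {x y} hxy => by
    have := hhsup x y
    rw [sup_eq_right.2 (show x ≤ y from hxy)] at this
    rw [this]
    exact le_max_left _ _
  have hu0 : 0 ≤ h ⟨u, huI⟩ := by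
    simpa using hmono (x := 0) (y := ⟨u, huI⟩) hu
  have hr := intervalRetraction_mem hmM
  let r := intervalRetraction m M
  have hmI := hδI m ⟨le_rfl, hmM⟩
  have hMI := hδI M ⟨hmM, le_rfl⟩
  have hu_eq : h ⟨u, huI⟩ = |h ⟨δ m, hmI⟩| + |h ⟨δ M, hMI⟩| := by
    rw [← habs hmI, ← habs hMI, ← map_add]; rfl
  have hspos : 0 < h ⟨u, huI⟩ := by
    refine hu0.lt_of_ne fun h0 => ?_
    obtain ⟨c, -, h1, -⟩ := habsI hgI
    have := hmono (x := ⟨|g|, habsI hgI⟩) (y := c • ⟨u, huI⟩) h1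
    rw [map_smul, ← h0, smul_zero] at this
    rw [← h0, mul_zero] at hpos
    linarith
  set s := h ⟨u, huI⟩ with hs
  have hs' : 0 ≤ s⁻¹ := (inv_pos.2 hspos).le
  -- The homomorphism `h ∘ δ ∘ r / s`, where `s = h (|δ m| + |δ M|)`.
  let ψ : LatticeHom L ℝ :=
    { toFun := fun x => s⁻¹ * h ⟨δ (r x), hδI _ (hr x)⟩
      map_sup' := fun x y => by
        refine Eq.trans ?_ (mul_max_of_nonneg _ _ hs')
        rw [← hhsup]
        congr 2
        exact Subtype.ext (by change δ (r (x ⊔ y)) = δ (r x) ⊔ δ (r y); simp only [map_sup])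
      map_inf' := fun x y => by
        refine Eq.trans ?_ (mul_min_of_nonneg _ _ hs')
        rw [← hhinf]
        congr 2
        exact Subtype.ext (by change δ (r (x ⊓ y)) = δ (r x) ⊓ δ (r y); simp only [map_inf]) }
  have hψ : ∀ x (hx : x ∈ Icc m M), ψ x = s⁻¹ * h ⟨δ x, hδI x hx⟩ := fun x hx => by
    change s⁻¹ * h ⟨δ (r x), hδI _ (hr x)⟩ = _
    simp only [r, intervalRetraction_eq hx]
  have hψ1 : ∀ x, ψ x ∈ Icc (-1 : ℝ) 1 := fun x => by
    refine abs_le.1 ?_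
    change |s⁻¹ * h ⟨δ (r x), hδI _ (hr x)⟩| ≤ 1
    rw [abs_mul, abs_of_nonneg hs', inv_mul_le_one₀ hspos, ← habs, hs]
    obtain ⟨c1, c2⟩ := hr x
    refine hmono (abs_le'.2 ⟨?_, ?_⟩)
    · exact (OrderHomClass.mono δ c2).trans
        ((le_abs_self _).trans (le_add_of_nonneg_left (abs_nonneg _)))
    · exact (neg_le_neg (OrderHomClass.mono δ c1)).trans
        ((neg_le_abs _).trans (le_add_of_nonneg_right (abs_nonneg _)))
  have hψ0 : ∃ x, ψ x ≠ 0 := by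
    by_contra! hψ0
    have h1 := hψ0 m
    have h2 := hψ0 M
    rw [hψ m ⟨le_rfl, hmM⟩, mul_eq_zero, or_iff_right (inv_ne_zero hspos.ne')] at h1
    rw [hψ M ⟨hmM, le_rfl⟩, mul_eq_zero, or_iff_right (inv_ne_zero hspos.ne')] at h2
    rw [h1, h2, abs_zero, add_zero] at hu_eq
    exact hspos.ne' hu_eq
  let φ : NonzeroLStar L := ⟨⟨ψ, hψ1⟩, hψ0⟩
  -- Evaluation at `φ` and `h / s` agree on the vector sublattice generated by `[m, M]`.
  let S : Submodule ℝ F :=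
    { carrier := {x | ∃ hx : x ∈ principalIdeal u, R x φ = s⁻¹ * h ⟨x, hx⟩}
      zero_mem' := by
        refine ⟨Submodule.zero_mem _, ?_⟩
        have : h ⟨0, Submodule.zero_mem _⟩ = 0 := map_zero h
        rw [this, map_zero, mul_zero]; rfl
      add_mem' := by
        rintro x y ⟨hx, hx'⟩ ⟨hy, hy'⟩
        refine ⟨Submodule.add_mem _ hx hy, ?_⟩
        have : h ⟨x + y, Submodule.add_mem _ hx hy⟩ = h ⟨x, hx⟩ + h ⟨y, hy⟩ :=
          map_add h ⟨x, hx⟩ ⟨y, hy⟩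
        rw [this, map_add, Pi.add_apply, hx', hy', mul_add]
      smul_mem' := by
        rintro c x ⟨hx, hx'⟩
        refine ⟨Submodule.smul_mem _ c hx, ?_⟩
        have : h ⟨c • x, Submodule.smul_mem _ c hx⟩ = c * h ⟨x, hx⟩ :=
          map_smul h c ⟨x, hx⟩
        rw [this, map_smul, Pi.smul_apply, hx', smul_eq_mul, mul_left_comm] }
  have hS : IsVectorSublattice S := by
    rintro x y ⟨hx, hx'⟩ ⟨hy, hy'⟩
    obtain ⟨h1, h2⟩ := hI hx hy
    refine ⟨⟨h1, ?_⟩, ⟨h2, ?_⟩⟩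
    · have : h ⟨x ⊔ y, h1⟩ = max (h ⟨x, hx⟩) (h ⟨y, hy⟩) := hhsup ⟨x, hx⟩ ⟨y, hy⟩
      rw [this, hsup, Pi.sup_apply, hx', hy', mul_max_of_nonneg _ _ hs']
    · have : h ⟨x ⊓ y, h2⟩ = min (h ⟨x, hx⟩) (h ⟨y, hy⟩) := hhinf ⟨x, hx⟩ ⟨y, hy⟩
      rw [this, hinf, Pi.inf_apply, hx', hy', mul_min_of_nonneg _ _ hs']
  have hgS : g ∈ S := latSpan_le hS (by
    rintro _ ⟨x, hx, rfl⟩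
    exact ⟨hδI x hx, (hδ x φ).trans (hψ x hx)⟩) hg
  obtain ⟨_, hgφ⟩ := hgS
  have h1 := hε φ
  rw [hgφ, abs_mul, abs_of_nonneg hs', ← habs hgI, inv_mul_le_iff₀ hspos] at h1
  linarith

/-- On the vector sublattice generated by `L`, the norm is dominated by the supremum norm over
`L^* \ {0}`. -/
theorem norm_le_of_forall_abs_le [Nonempty L] (δ : LatticeHom L F)
    (R : F →ₗ[ℝ] NonzeroLStar L → ℝ)
    (hsup : ∀ x y, R (x ⊔ y) = R x ⊔ R y) (hinf : ∀ x y, R (x ⊓ y) = R x ⊓ R y)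
    (hδ : ∀ x φ, R (δ x) φ = φ.1.1 x) {C : ℝ} (hC : ∀ x, ‖δ x‖ ≤ C) {g : F}
    (hg : g ∈ latSpan (range δ)) {ε : ℝ} (hε0 : 0 ≤ ε) (hε : ∀ φ, |R g φ| ≤ ε) :
    ‖g‖ ≤ ε * (2 * C) := by
  obtain ⟨m, M, hmM, hg⟩ := exists_mem_latSpan_image_Icc δ hg
  have h := abs_le_smul_of_forall_abs_le δ R hsup hinf hδ hmM hg hε
  calc ‖g‖ ≤ ‖ε • (|δ m| + |δ M|)‖ := norm_le_norm_of_abs_le_abs (h.trans (le_abs_self _))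
    _ = ε * ‖|δ m| + |δ M|‖ := by rw [norm_smul, Real.norm_of_nonneg hε0]
    _ ≤ ε * (2 * C) := by
      gcongr
      refine (norm_add_le _ _).trans ?_
      rw [norm_abs_eq_norm, norm_abs_eq_norm]
      linarith [hC m, hC M]

end Estimate

/-! ### Free Banach lattices -/

section Free

variable {F : Type u} [NormedAddCommGroup F] [NormedSpace ℝ F] [Lattice F] [IsBanachLattice F]

theorem isVectorSublattice_topologicalClosure {S : Submodule ℝ F} (hS : IsVectorSublattice S) :
    IsVectorSublattice S.topologicalClosure := fun _ _ hx hy =>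
  ⟨map_mem_closure₂ continuous_sup hx hy fun _ ha _ hb => (hS ha hb).1,
    map_mem_closure₂ continuous_inf hx hy fun _ ha _ hb => (hS ha hb).2⟩

/-- A closed vector sublattice of a Banach lattice is a Banach lattice. -/
theorem IsVectorSublattice.isBanachLattice {S : Submodule ℝ F} (hS : IsVectorSublattice S)
    (hc : IsClosed (S : Set F)) :
    letI := hS.lattice
    IsBanachLattice S :=
  let := hS.lattice
  { add_le_add_left := fun _ _ h c => add_le_add_left (α := F) h c
    smul_le_smul_of_nonneg_left := fun _ hc _ _ h =>
      smul_le_smul_of_nonneg_left (β := F) h hc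
    smul_le_smul_of_nonneg_right := fun _ hb _ _ h =>
      smul_le_smul_of_nonneg_right (β := F) h hb
    solid := fun _ _ h => norm_le_norm_of_abs_le_abs (α := F) h
    toCompleteSpace := hc.completeSpace_coe }

instance (K : Type*) [TopologicalSpace K] : IsBanachLattice (BoundedContinuousFunction K ℝ) where
  smul_le_smul_of_nonneg_left _ hc _ _ h k := mul_le_mul_of_nonneg_left (h k) hc
  smul_le_smul_of_nonneg_right _ hf _ _ h k := mul_le_mul_of_nonneg_right h (hf k)

/-- A free Banach lattice is generated by `L` as a Banach lattice: the extension of `δ` to a map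
into the closed vector sublattice generated by `L` is the identity, by uniqueness. -/
theorem IsFreeBanachLattice.mem_closure_latSpan {L : Type u} [Lattice L] {δ : LatticeHom L F}
    (hF : IsFreeBanachLattice L F δ) (f : F) :
    f ∈ (latSpan (range δ)).topologicalClosure := by
  let G := (latSpan (range δ)).topologicalClosure
  have hG : IsVectorSublattice G :=
    isVectorSublattice_topologicalClosure (isVectorSublattice_latSpan _)
  let := hG.lattice
  have := hG.isBanachLattice (Submodule.isClosed_topologicalClosure _)
  have hδG : ∀ x, δ x ∈ G := fun x =>
    Submodule.le_topologicalClosure _ (subset_latSpan _ (mem_range_self x))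
  let T : LatticeHom L G :=
    { toFun := fun x => ⟨δ x, hδG x⟩
      map_sup' := fun x y => Subtype.ext (map_sup δ x y)
      map_inf' := fun x y => Subtype.ext (map_inf δ x y) }
  obtain ⟨T', ⟨hT', hTδ⟩, -, -⟩ := hF.lift G T hF.bounded
  obtain ⟨S, -, -, hS⟩ := hF.lift F δ hF.bounded
  have h1 := hS (G.subtypeL.comp T')
    (fun x y => ⟨congrArg Subtype.val (hT' x y).1, congrArg Subtype.val (hT' x y).2⟩)
    fun x => congrArg Subtype.val (hTδ x)
  have h2 := hS (ContinuousLinearMap.id ℝ F) (fun _ _ => ⟨rfl, rfl⟩) fun _ => rfl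
  have h3 : (T' f : F) = f := DFunLike.congr_fun (h1.trans h2.symm) f
  rw [← h3]
  exact (T' f).2

variable {L : Type u} [DistribLattice L]

variable (L) in
/-- The evaluations as a lattice homomorphism from `L` to the bounded continuous functions on
`L^* \ {0}`. -/
noncomputable def evalBounded :
    LatticeHom L (BoundedContinuousFunction (NonzeroLStar L) ℝ) where
  toFun x := BoundedContinuousFunction.ofNormedAddCommGroup (fun φ => φ.1.1 x)
    ((continuous_evalDelta x).comp continuous_subtype_val) 1 fun φ => abs_le.2 (φ.1.2 x)
  map_sup' x y := BoundedContinuousFunction.ext fun φ => map_sup φ.1.1 x y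
  map_inf' x y := BoundedContinuousFunction.ext fun φ => map_inf φ.1.1 x y

theorem norm_evalBounded_le (x : L) : ‖evalBounded L x‖ ≤ 1 :=
  BoundedContinuousFunction.norm_ofNormedAddCommGroup_le _ zero_le_one fun φ => abs_le.2 (φ.1.2 x)

theorem IsFreeBanachLattice.isProjectionBand_iff [Nontrivial L] {δ : LatticeHom L F}
    (hF : IsFreeBanachLattice L F δ) (B : Submodule ℝ F) :
    IsProjectionBand B ↔ B = ⊥ ∨ B = ⊤ := by
  obtain ⟨T, ⟨hT, hTδ⟩, -, -⟩ := hF.lift _ (evalBounded L) ⟨1, by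
    rintro _ ⟨x, rfl⟩
    exact norm_evalBounded_le x⟩
  obtain ⟨C, hC⟩ := hF.bounded
  have hC : ∀ x, ‖δ x‖ ≤ C := fun x => hC (mem_range_self x)
  have hC0 : 0 ≤ C := (norm_nonneg _).trans (hC (Classical.arbitrary L))
  let R : F →ₗ[ℝ] NonzeroLStar L → ℝ :=
    { toFun := fun f => T f
      map_add' := fun f g => by rw [map_add]; rfl
      map_smul' := fun c f => by rw [map_smul]; rfl }
  have hsup : ∀ x y, R (x ⊔ y) = R x ⊔ R y := fun x y =>
    congrArg (fun f : BoundedContinuousFunction (NonzeroLStar L) ℝ => (f : _ → ℝ)) (hT x y).1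
  have hinf : ∀ x y, R (x ⊓ y) = R x ⊓ R y := fun x y =>
    congrArg (fun f : BoundedContinuousFunction (NonzeroLStar L) ℝ => (f : _ → ℝ)) (hT x y).2
  have hδ : ∀ x φ, R (δ x) φ = φ.1.1 x := fun x φ =>
    congrArg (fun f : BoundedContinuousFunction (NonzeroLStar L) ℝ => f φ) (hTδ x)
  -- The estimate on the dense sublattice extends to all of `F`, so `R` is injective.
  have hnorm : ∀ f, ‖f‖ ≤ ‖T f‖ * (2 * C) := by
    refine fun f => closure_minimal (t := {f | ‖f‖ ≤ ‖T f‖ * (2 * C)}) (fun g hg => ?_)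
      (isClosed_le continuous_norm (by fun_prop)) (hF.mem_closure_latSpan f)
    exact norm_le_of_forall_abs_le δ R hsup hinf hδ hC hg (norm_nonneg _)
      fun φ => (T g).norm_coe_le_norm φ
  refine isProjectionBand_iff_of_connected R ((injective_iff_map_eq_zero _).2 fun f hf => ?_)
    (fun f => (T f).continuous) hsup hinf δ (fun φ => ?_) B
  · have hTf : T f = 0 := BoundedContinuousFunction.ext fun φ => congrFun hf φ
    have := hnorm f
    rw [hTf, norm_zero, zero_mul] at this
    exact norm_le_zero_iff.1 this
  · obtain ⟨x, hx⟩ := φ.2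
    exact ⟨x, by rwa [hδ]⟩

end Free

theorem theorem5p4 (L : Type u) [DistribLattice L] [Nontrivial L] :
    (∀ (F : Type u) [NormedAddCommGroup F] [NormedSpace ℝ F] [Lattice F] [IsBanachLattice F]
      (δ : LatticeHom L F), IsFreeBanachLattice L F δ →
        ∀ B : Submodule ℝ F, IsProjectionBand B ↔ B = ⊥ ∨ B = ⊤) ∧
    (∀ B : Submodule ℝ (FBL L), IsProjectionBand B ↔ B = ⊥ ∨ B = ⊤) :=
  ⟨fun _ _ _ _ _ _ hF B => hF.isProjectionBand_iff B, FBL.isProjectionBand_iff L⟩
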